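/- For an integer quadruple $\mathbf v=(a,b,c,d)$ put $Q_{\mathcal D}(\mathbf v)=2(a^2+b^2+c^2+d^2)-(a+b+c+d)^2$, $L(\mathbf v)=a+b+c+d$ and $|\mathbf v|=|a|+|b|+|c|+|d|$. For $1\le i\le 4$ let $\mathbf S_i$ be the linear map that replaces the $i$-th entry of $\mathbf v$ by twice the sum of the other three entries minus the $i$-th entry (and fixes the other three). A nonzero integer quadruple is called reduced if $|\mathbf S_i\mathbf v|\ge|\mathbf v|$ for $i=1,2,3,4$. An ordered quadruple $a\le b\le c\le d$ with $L(\mathbf v)\ge 0$ is called a root quadruple if it is reduced and $a+b+c\ge d>0$. (A reduced ordered quadruple with $L(\mathbf v)<0$ is called a root quadruple if $(-d,-c,-b,-a)$ is one; these are not counted below.) For integers $k$ and $n$, let $N_{\rm root}(k;-n)$ be the number of ordered integer root quadruples $\mathbf v=(a,b,c,d)$ with $Q_{\mathcal D}(\mathbf v)=k$, $L(\mathbf v)>0$ and smallest entry $a=-n$. **Theorem.** For all integers $m$, uniformly for integers $n>\sqrt{|m|}$, $$N_{\rm root}(4m;-n)=O\bigl(n\,(\log n)\,(\log\log n)^2\bigr),$$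 where the implied constant does not depend on $m$. Explicitly, there is an absolute constant $C$ such that for all integers $m$ and $n$ with $n\ge 2$ and $n>\sqrt{|m|}$ the number $N_{\rm root}(4m;-n)$ is finite and $$N_{\rm root}(4m;-n)\le C\,n\,(\log n)\,(\log\log n)^2 .$$ -/

import Mathlib

namespace Apollonian

/-- An integer quadruple `(a, b, c, d)`, with entries `v 0, v 1, v 2, v 3`. -/
abbrev Quadruple : Type := Fin 4 → ℤ

/-- The Descartes quadratic form `2(w² + x² + y² + z²) - (w + x + y + z)²`. -/
def descartesForm (v : Quadruple) : ℤ :=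
  2 * ∑ i, v i ^ 2 - (∑ i, v i) ^ 2

/-- `L(v)`, the sum of the entries. -/
def entrySum (v : Quadruple) : ℤ := ∑ i, v i

/-- `|v| = |a| + |b| + |c| + |d|`, the size decreased by the reduction algorithm. -/
def size (v : Quadruple) : ℤ := ∑ i, |v i|

/-- The four generators `S₁, S₂, S₃, S₄` of the Apollonian group. -/
def generator : Fin 4 → Matrix (Fin 4) (Fin 4) ℤ :=
  ![!![-1, 2, 2, 2; 0, 1, 0, 0; 0, 0, 1, 0; 0, 0, 0, 1],
    !![1, 0, 0, 0; 2, -1, 2, 2; 0, 0, 1, 0; 0, 0, 0, 1],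
    !![1, 0, 0, 0; 0, 1, 0, 0; 2, 2, -1, 2; 0, 0, 0, 1],
    !![1, 0, 0, 0; 0, 1, 0, 0; 0, 0, 1, 0; 2, 2, 2, -1]]

/-- A quadruple is reduced if it is nonzero and the reduction algorithm halts at it: no generator
of the Apollonian group strictly decreases its size. -/
def IsReducedQuadruple (v : Quadruple) : Prop :=
  v ≠ 0 ∧ ∀ i, size v ≤ size ((generator i).mulVec v)

/-- An ordered (`a ≤ b ≤ c ≤ d`) root quadruple with `L(v) ≥ 0`: a reduced quadruple with
`a + b + c ≥ d > 0`. -/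
def IsRootNonneg (v : Quadruple) : Prop :=
  Monotone v ∧ IsReducedQuadruple v ∧ 0 ≤ entrySum v ∧ v 3 ≤ v 0 + v 1 + v 2 ∧ 0 < v 3

/-- `v* = (-d, -c, -b, -a)`. -/
def dual (v : Quadruple) : Quadruple := fun i => -v i.rev

/-- Ordered root quadruples. When `L(v) < 0` the quadruple is a root quadruple if and only if it is
reduced and `v*` is a root quadruple. -/
def IsRoot (v : Quadruple) : Prop :=
  IsRootNonneg v ∨ (entrySum v < 0 ∧ IsReducedQuadruple v ∧ IsRootNonneg (dual v))

/-- The ordered integer root quadruples `v` with `Q_D(v) = k`, `L(v) > 0` and smallest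
entry `w`. -/
def rootQuadruples (k w : ℤ) : Set Quadruple :=
  {v | IsRoot v ∧ descartesForm v = k ∧ 0 < entrySum v ∧ v 0 = w}

/-- `N_root(k; w)`, a number that can be infinite. -/
noncomputable def Nroot (k w : ℤ) : ℕ∞ := (rootQuadruples k w).encard

end Apollonian

/-! With `B = b - n`, `2s = a + b + c - d`, `C = c - n`, a root quadruple becomes a reduced binary
form: `B * C - s ^ 2 = D`, `0 ≤ 2s ≤ B ≤ C`, where `D = n ^ 2 - m` lies strictly between `0` and `2n
^ 2`. Reduction forces `B ≤ 2n`, and `(B, s)` determines the quadruple, so it suffices to sum over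
`B ≤ 2n` the number of square roots of `-D` modulo `B`.

If `g = gcd(B, D) = f ^ 2 * h` with `h` squarefree, there are at most `2f` times the number of
divisors of `B / g` such roots (`card_negSquareRoots_le`). Summing over `B = g * k` gives `O(n log
n)` times `∑ f / g` over `g ∣ D`. As `f / g = 1 / (f * h)`, that sum is at most the square of `∑ 1 /
e` over `e ∣ D`, which is `O(log log D)` (`reciprocalDivisorSum_le`). -/

namespace Apollonian

/-! ### Sums of reciprocals of divisors -/

section ReciprocalDivisorSum

open Finset ArithmeticFunction

/-- The sum of `1 / e` over the divisors `e` of `D`. -/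
noncomputable def reciprocalDivisorSum (D : ℕ) : ℝ := ∑ e ∈ D.divisors, (e : ℝ)⁻¹

lemma reciprocalDivisorSum_nonneg (D : ℕ) : 0 ≤ reciprocalDivisorSum D :=
  sum_nonneg fun _ _ => by positivity

/-- The upper bound in Mertens' first theorem. -/
lemma sum_vonMangoldt_div_le (N : ℕ) :
    ∑ q ∈ Ioc 0 N, Λ q / q ≤ Real.log N + (Real.log 4 + 4) := by
  rcases Nat.eq_zero_or_pos N with rfl | hN
  · simp; positivity
  have hNR : (0 : ℝ) < N := by exact_mod_cast hN
  -- The left side is `log N!`. Removing the floors costs `ψ(N)`, which Chebyshev's bound controls.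
  have h1 : ∑ q ∈ Ioc 0 N, Λ q * ((N / q : ℕ) : ℝ) ≤ N * Real.log N := by
    rw [← sum_Ioc_mul_zeta_eq_sum, vonMangoldt_mul_zeta]
    calc ∑ k ∈ Ioc 0 N, ArithmeticFunction.log k ≤ ∑ k ∈ Ioc 0 N, Real.log N := by
          refine sum_le_sum fun k hk => ?_
          rw [mem_Ioc] at hk
          rw [log_apply]
          exact Real.log_le_log (by exact_mod_cast hk.1) (by exact_mod_cast hk.2)
      _ = N * Real.log N := by simp
  have h2 : ∑ q ∈ Ioc 0 N, Λ q ≤ (Real.log 4 + 4) * N := by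
    simpa [Chebyshev.psi] using Chebyshev.psi_le_const_mul_self hNR.le
  have h3 : N * ∑ q ∈ Ioc 0 N, Λ q / q ≤
      ∑ q ∈ Ioc 0 N, (Λ q * ((N / q : ℕ) : ℝ) + Λ q) := by
    rw [mul_sum]
    refine sum_le_sum fun q hq => ?_
    have h : (N : ℝ) / q ≤ ((N / q : ℕ) : ℝ) + 1 := by
      rw [← Nat.floor_div_eq_div (K := ℝ)]
      exact (Nat.lt_floor_add_one _).le
    have := mul_le_mul_of_nonneg_left h (vonMangoldt_nonneg (n := q))
    calc (N : ℝ) * (Λ q / q) = Λ q * (N / q) := by ring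
      _ ≤ _ := by linarith
  rw [sum_add_distrib] at h3
  refine le_of_mul_le_mul_left (h3.trans ?_) hNR
  linarith

/-- Mertens handles `q ≤ y`. The larger `q` contribute at most `(∑ Λ q) / y = log D / y ≤ 1`. -/
lemma sum_divisors_vonMangoldt_div_le {D : ℕ} {y : ℝ} (hy : 1 ≤ y)
    (hDy : Real.log D ≤ y) :
    ∑ q ∈ D.divisors, Λ q / q ≤ Real.log y + (Real.log 4 + 5) := by
  have hy0 : 0 < y := by linarith
  have hle : ∀ q ∈ D.divisors,
      Λ q / q ≤ (if q ∈ Ioc 0 ⌊y⌋₊ then Λ q / q else 0) + Λ q / y := by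
    intro q hq
    have hq0 : 0 < q := Nat.pos_of_mem_divisors hq
    have hΛ : 0 ≤ Λ q := vonMangoldt_nonneg
    split_ifs with h
    · have : 0 ≤ Λ q / y := by positivity
      linarith
    · have hqy : y ≤ q := by
        simp only [mem_Ioc, not_and, not_le] at h
        exact (Nat.lt_of_floor_lt (h hq0)).le
      rw [zero_add]
      gcongr
  have h1 : ∑ q ∈ D.divisors, (if q ∈ Ioc 0 ⌊y⌋₊ then Λ q / q else 0)
      ≤ ∑ q ∈ Ioc 0 ⌊y⌋₊, Λ q / q := by
    rw [← sum_filter]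
    refine sum_le_sum_of_subset_of_nonneg (fun q hq => (mem_filter.1 hq).2) fun q _ _ => ?_
    have : 0 ≤ Λ q := vonMangoldt_nonneg
    positivity
  have h2 : ∑ q ∈ D.divisors, Λ q / y ≤ 1 := by
    rw [← sum_div, vonMangoldt_sum]
    exact div_le_one_of_le₀ hDy hy0.le
  have h3 : Real.log ⌊y⌋₊ ≤ Real.log y :=
    Real.log_le_log (by exact_mod_cast Nat.floor_pos.2 hy) (Nat.floor_le hy0.le)
  have h4 := sum_le_sum hle
  rw [sum_add_distrib] at h4
  linarith [sum_vonMangoldt_div_le ⌊y⌋₊]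

/-- Expand `log e = ∑ Λ q` over `q ∣ e` and write `e = q * e'`: the pairs `(q, e')` are distinct
pairs of divisors of `D`. -/
lemma sum_divisors_log_div_le (D : ℕ) :
    ∑ e ∈ D.divisors, Real.log e / e ≤
      (∑ q ∈ D.divisors, Λ q / q) * reciprocalDivisorSum D := by
  have h1 : ∑ e ∈ D.divisors, Real.log e / e
      = ∑ x ∈ D.divisors.sigma fun e => e.divisors, Λ x.2 / x.1 := by
    rw [sum_sigma]
    refine sum_congr rfl fun e _ => ?_
    rw [← vonMangoldt_sum, sum_div]
  rw [h1, reciprocalDivisorSum, sum_mul_sum, ← sum_product']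
  have hnn : ∀ x : ℕ × ℕ, 0 ≤ Λ x.1 / x.1 * (x.2 : ℝ)⁻¹ := fun x => by
    have : 0 ≤ Λ x.1 := vonMangoldt_nonneg
    positivity
  have hmem : ∀ x ∈ D.divisors.sigma fun e => e.divisors,
      x.1 ∣ D ∧ D ≠ 0 ∧ x.2 ∣ x.1 ∧ x.1 ≠ 0 ∧ x.2 ≠ 0 := by
    rintro ⟨e, q⟩ hx
    simp only [mem_sigma, Nat.mem_divisors] at hx
    exact ⟨hx.1.1, hx.1.2, hx.2.1, hx.2.2, ne_zero_of_dvd_ne_zero hx.2.2 hx.2.1⟩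
  have hinj : Set.InjOn (fun x : (_ : ℕ) × ℕ => (x.2, x.1 / x.2))
      (D.divisors.sigma fun e => e.divisors : Finset _) := by
    rintro ⟨e, q⟩ hx ⟨e', q'⟩ hx' h
    obtain ⟨-, -, h1, -, -⟩ := hmem _ hx
    obtain ⟨-, -, h2, -, -⟩ := hmem _ hx'
    simp only [Prod.mk.injEq] at h h1 h2
    obtain ⟨rfl, h⟩ := h
    have : e = e' := by rw [← Nat.div_mul_cancel h1, h, Nat.div_mul_cancel h2]
    subst this
    rfl
  calc ∑ x ∈ D.divisors.sigma fun e => e.divisors, Λ x.2 / x.1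
      = ∑ x ∈ D.divisors.sigma fun e => e.divisors,
          Λ x.2 / x.2 * ((x.1 / x.2 : ℕ) : ℝ)⁻¹ := by
        refine sum_congr rfl fun x hx => ?_
        obtain ⟨-, -, h1, h2, h3⟩ := hmem x hx
        have h3' : (x.2 : ℝ) ≠ 0 := by exact_mod_cast h3
        have h2' : (x.1 : ℝ) ≠ 0 := by exact_mod_cast h2
        rw [Nat.cast_div h1 h3']
        field_simp
    _ = ∑ x ∈ (D.divisors.sigma fun e => e.divisors).image fun x => (x.2, x.1 / x.2),
          Λ x.1 / x.1 * (x.2 : ℝ)⁻¹ := by rw [sum_image hinj]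
    _ ≤ _ := by
        refine sum_le_sum_of_subset_of_nonneg (fun y hy => ?_) fun x _ _ => hnn x
        obtain ⟨x, hx, rfl⟩ := mem_image.1 hy
        obtain ⟨h1, h2, h3, -, -⟩ := hmem x hx
        simp only [mem_product, Nat.mem_divisors]
        exact ⟨⟨h3.trans h1, h2⟩, (Nat.div_dvd_of_dvd h3).trans h1, h2⟩

/-- Rankin's trick: the sum is part of the series for `ζ(1 + ε)`. -/
lemma sum_divisors_exp_le (D : ℕ) {ε : ℝ} (hε : 0 < ε) :
    ∑ e ∈ D.divisors, (e : ℝ)⁻¹ * Real.exp (-(ε * Real.log e)) ≤ 1 + 1 / ε := by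
  have hs : 1 < 1 + ε := by linarith
  have hnn : 0 ≤ ZetaAsymptotics.termTSum (1 + ε) :=
    tsum_nonneg fun n => ZetaAsymptotics.term_nonneg (n + 1) _
  rw [ZetaAsymptotics.termTSum_of_lt hs] at hnn
  have hsum : Summable fun n : ℕ => 1 / (n : ℝ) ^ (1 + ε) :=
    Real.summable_one_div_nat_rpow.2 hs
  have hshift : ∑' n : ℕ, 1 / (n + 1 : ℝ) ^ (1 + ε) = ∑' n : ℕ, 1 / (n : ℝ) ^ (1 + ε) := by
    rw [hsum.tsum_eq_zero_add]
    simp [Real.zero_rpow (by linarith : 1 + ε ≠ 0)]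
  have h1 : ∑' n : ℕ, 1 / (n : ℝ) ^ (1 + ε) ≤ 1 + 1 / ε := by
    rw [← hshift]
    set T := ∑' n : ℕ, 1 / (n + 1 : ℝ) ^ (1 + ε)
    rw [add_sub_cancel_left, one_div_mul_eq_div] at hnn
    have : T / (1 + ε) ≤ 1 / ε := by linarith
    rw [div_le_iff₀ (by linarith)] at this
    calc T ≤ 1 / ε * (1 + ε) := this
      _ = 1 + 1 / ε := by field_simp; ring
  refine le_trans ?_ h1
  calc ∑ e ∈ D.divisors, (e : ℝ)⁻¹ * Real.exp (-(ε * Real.log e))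
      = ∑ e ∈ D.divisors, 1 / (e : ℝ) ^ (1 + ε) := by
        refine sum_congr rfl fun e he => ?_
        have he0 : (0 : ℝ) < e := by exact_mod_cast Nat.pos_of_mem_divisors he
        rw [Real.rpow_add he0, Real.rpow_one, Real.rpow_def_of_pos he0, Real.exp_neg,
          mul_comm (Real.log _)]
        field_simp
    _ ≤ _ := hsum.sum_le_tsum _ fun e _ => by positivity

/-- The sum of the reciprocals of the divisors of `D` is `O(log log D)`. -/
lemma reciprocalDivisorSum_le {D : ℕ} {y : ℝ} (hy : 3 ≤ y)
    (hDy : Real.log D ≤ y) :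
    reciprocalDivisorSum D ≤ 2 * Real.exp (Real.log 4 + 6) * Real.log y := by
  have hlog : 1 ≤ Real.log y := by
    rw [Real.le_log_iff_exp_le (by linarith)]
    linarith [Real.exp_one_lt_d9]
  set W := reciprocalDivisorSum D with hW
  set K := Real.log 4 + 6
  set ε := 1 / Real.log y with hε
  have hε0 : 0 < ε := by positivity
  have hW0 : 0 ≤ W := reciprocalDivisorSum_nonneg D
  have hM : ε * ∑ e ∈ D.divisors, Real.log e / e ≤ K * W := by
    have h1 := sum_divisors_vonMangoldt_div_le (by linarith) hDy
    have h2 : ε * ∑ q ∈ D.divisors, Λ q / q ≤ K := by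
      rw [hε, one_div_mul_eq_div, div_le_iff₀ (by linarith)]
      have : 0 < Real.log 4 := Real.log_pos (by norm_num)
      nlinarith
    calc ε * ∑ e ∈ D.divisors, Real.log e / e
        ≤ ε * ((∑ q ∈ D.divisors, Λ q / q) * W) := by
          gcongr
          exact sum_divisors_log_div_le D
      _ = (ε * ∑ q ∈ D.divisors, Λ q / q) * W := by ring
      _ ≤ K * W := by gcongr
  -- Jensen's inequality by hand: `exp (-x)` lies above its tangent at `K`, where `K` bounds the
  -- mean of `ε * log e` under the weights `1 / e`.
  have htan : ∀ e ∈ D.divisors, Real.exp (-K) * ((1 + K) * (e : ℝ)⁻¹ - ε * (Real.log e / e)) ≤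
      (e : ℝ)⁻¹ * Real.exp (-(ε * Real.log e)) := by
    intro e _
    have h := Real.add_one_le_exp (K - ε * Real.log e)
    have h' : Real.exp (-(ε * Real.log e)) = Real.exp (-K) * Real.exp (K - ε * Real.log e) := by
      rw [← Real.exp_add]; congr 1; ring
    rw [h']
    calc Real.exp (-K) * ((1 + K) * (e : ℝ)⁻¹ - ε * (Real.log e / e))
        = (e : ℝ)⁻¹ * (Real.exp (-K) * (K - ε * Real.log e + 1)) := by ring
      _ ≤ _ := by gcongr
  have h1 := (sum_le_sum htan).trans (sum_divisors_exp_le D hε0)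
  rw [← mul_sum, sum_sub_distrib, ← mul_sum, ← mul_sum, ← reciprocalDivisorSum, ← hW, hε,
    one_div_one_div, ← hε] at h1
  have h2 : Real.exp (-K) * W ≤ 2 * Real.log y := by
    refine le_trans ?_ (h1.trans (by linarith))
    gcongr
    linarith
  calc W = Real.exp K * (Real.exp (-K) * W) := by
        rw [← mul_assoc, ← Real.exp_add]; simp
    _ ≤ Real.exp K * (2 * Real.log y) := by gcongr
    _ = _ := by ring

end ReciprocalDivisorSum

end Apollonian

namespace Apollonian

/-! ### Square roots of `-D` to a varying modulus -/

section SquareRootCount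

open Finset

/-- Two solutions `t`, `u` of `g * t ^ 2 + D ≡ 0 [ZMOD M]` with the same greatest common divisor
`gcd (t - r, M)`, where `r` is a third solution, are congruent modulo `M / gcd (2, M)`. -/
lemma dvd_two_mul_sub_of_gcd_eq {M g D r t u : ℤ} (hco : IsCoprime M (g * r))
    (hr : M ∣ g * r ^ 2 + D) (ht : M ∣ g * t ^ 2 + D) (hu : M ∣ g * u ^ 2 + D)
    (h : Int.gcd (t - r) M = Int.gcd (u - r) M) (hM : M ≠ 0) : M ∣ 2 * (t - u) := by
  have hg : IsCoprime M g := hco.of_mul_right_left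
  have key : ∀ x : ℤ, M ∣ g * x ^ 2 + D → M / (Int.gcd (x - r) M : ℤ) ∣ x + r := by
    intro x hx
    have h1 : M ∣ g * ((x - r) * (x + r)) := by
      have := dvd_sub hx hr
      rwa [show g * x ^ 2 + D - (g * r ^ 2 + D) = g * ((x - r) * (x + r)) by ring] at this
    have h2 : M ∣ (x - r) * (x + r) := hg.dvd_of_dvd_mul_left h1
    set e : ℤ := (Int.gcd (x - r) M : ℤ) with he
    have he0 : e ≠ 0 := by
      rw [he]; exact_mod_cast Int.gcd_ne_zero_right hM
    obtain ⟨a, ha⟩ : e ∣ x - r := Int.gcd_dvd_left _ _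
    obtain ⟨b, hb⟩ : e ∣ M := Int.gcd_dvd_right _ _
    have hab : IsCoprime b a := by
      have hg' : Int.gcd (x - r) M = e.natAbs * Int.gcd a b := by
        conv_lhs => rw [ha, hb]
        exact Int.gcd_mul_left ..
      have hn : e.natAbs = Int.gcd (x - r) M := by rw [he]; simp
      rw [← hn] at hg'
      have hn0 : 0 < e.natAbs := Int.natAbs_pos.2 he0
      have : Int.gcd a b = 1 := by
        have := Nat.eq_of_mul_eq_mul_left hn0 ((mul_one _).trans hg')
        exact this.symm
      exact (Int.isCoprime_iff_gcd_eq_one.2 this).symm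
    rw [hb, Int.mul_ediv_cancel_left _ he0]
    rw [ha, hb, mul_assoc] at h2
    exact hab.dvd_of_dvd_mul_left (Int.dvd_of_mul_dvd_mul_left he0 h2)
  have h1 := key t ht
  have h2 := key u hu
  rw [← h] at h2
  set e : ℤ := (Int.gcd (t - r) M : ℤ) with he
  have het : e ∣ t - r := Int.gcd_dvd_left _ _
  have heu : e ∣ u - r := by rw [he, h]; exact Int.gcd_dvd_left _ _
  obtain ⟨b, hb⟩ : e ∣ M := Int.gcd_dvd_right _ _
  have he0 : e ≠ 0 := by rintro h0; rw [h0, zero_mul] at hb; exact hM hb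
  have hMb : M / e = b := by rw [hb, Int.mul_ediv_cancel_left _ he0]
  rw [hMb] at h1 h2
  have hetu : e ∣ t - u := by simpa using dvd_sub het heu
  have hbtu : b ∣ t - u := by simpa using dvd_sub h1 h2
  -- It divides `(t + r) - (t - r) = 2 * r`, and `r` is coprime to `M`.
  have hgcd : (Int.gcd e b : ℤ) ∣ 2 := by
    have h3 : (Int.gcd e b : ℤ) ∣ 2 * r := by
      have := dvd_sub ((Int.gcd_dvd_right e b).trans h1) ((Int.gcd_dvd_left e b).trans het)
      rwa [show t + r - (t - r) = 2 * r by ring] at this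
    have h4 : IsCoprime (Int.gcd e b : ℤ) r :=
      hco.of_mul_right_right.of_isCoprime_of_dvd_left
        ((Int.gcd_dvd_left e b).trans ⟨b, hb⟩)
    exact h4.dvd_of_dvd_mul_right h3
  obtain ⟨k, hk⟩ := hgcd
  have h5 : e * b ∣ (Int.gcd e b : ℤ) * (t - u) := by
    rw [Int.gcd_eq_gcd_ab e b, add_mul]
    refine dvd_add ?_ ?_
    · rw [mul_assoc]; exact mul_dvd_mul_left _ (hbtu.mul_left _)
    · rw [mul_assoc, mul_comm e]; exact mul_dvd_mul_left _ (hetu.mul_left _)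
  rw [hb, hk, mul_assoc, mul_left_comm]
  exact h5.mul_left k

/-- For `g = f ^ 2 * h` with `h` squarefree, `squareRootPart g = f`. -/
noncomputable def squareRootPart (g : ℕ) : ℕ := (Nat.sq_mul_squarefree g).choose_spec.choose

/-- For `g = f ^ 2 * h` with `h` squarefree, `squarefreePart g = h`. -/
noncomputable def squarefreePart (g : ℕ) : ℕ := (Nat.sq_mul_squarefree g).choose

lemma squareRootPart_sq_mul (g : ℕ) : squareRootPart g ^ 2 * squarefreePart g = g :=
  (Nat.sq_mul_squarefree g).choose_spec.choose_spec.1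

lemma squarefree_squarefreePart (g : ℕ) : Squarefree (squarefreePart g) :=
  (Nat.sq_mul_squarefree g).choose_spec.choose_spec.2

/-- The `s` modulo `B` with `s ^ 2 ≡ -D` modulo `B`. -/
def negSquareRoots (D B : ℕ) : Finset ℕ := {s ∈ range B | B ∣ s ^ 2 + D}

/-- Each root is `s = f * h * t` with `t < f * M`, `M = B / g`, and `h * t ^ 2 + E ≡ 0` modulo `M`,
where `E = D / g` is coprime to `M`. Relative to a fixed solution `r`, the divisor `gcd (t - r, M)`
determines `2 * t` modulo `M`, and the quotient `2 * t / M < 2 * f` then determines `t`. -/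
lemma card_negSquareRoots_le {D B : ℕ} (hB : 0 < B) :
    #(negSquareRoots D B) ≤
      2 * squareRootPart (B.gcd D) * #(B / B.gcd D).divisors := by
  set g := B.gcd D with hgdef
  set f := squareRootPart g
  set h := squarefreePart g
  have hg : f ^ 2 * h = g := squareRootPart_sq_mul g
  have hsq : Squarefree h := squarefree_squarefreePart g
  have hg0 : 0 < g := Nat.gcd_pos_of_pos_left _ hB
  have hf0 : 0 < f := Nat.pos_of_ne_zero fun h0 => by simp [h0] at hg; omega
  have hh0 : 0 < h := Nat.pos_of_ne_zero fun h0 => by simp [h0] at hg; omega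
  obtain ⟨M, hM⟩ : g ∣ B := Nat.gcd_dvd_left _ _
  obtain ⟨E, hE⟩ : g ∣ D := Nat.gcd_dvd_right _ _
  have hM0 : 0 < M := Nat.pos_of_ne_zero fun h0 => by simp [h0] at hM; omega
  have hBg : B / g = M := by rw [hM]; exact Nat.mul_div_cancel_left _ hg0
  have hME : M.Coprime E := by
    have := Nat.gcd_mul_left g M E
    rw [← hM, ← hE, ← hgdef] at this
    exact Nat.eq_of_mul_eq_mul_left hg0 (by rw [mul_one]; exact this.symm)
  rw [hBg]
  have hstruct : ∀ s ∈ negSquareRoots D B, ∃ t, s = f * h * t ∧ M ∣ h * t ^ 2 + E ∧ t < f * M := by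
    intro s hs
    rw [negSquareRoots, mem_filter, mem_range] at hs
    have hgs : g ∣ s ^ 2 := (Nat.dvd_add_left ⟨E, hE⟩).1 (Dvd.dvd.trans ⟨M, hM⟩ hs.2)
    obtain ⟨u, hu⟩ : f ∣ s :=
      (Nat.pow_dvd_pow_iff two_ne_zero).1 (Dvd.dvd.trans ⟨h, hg.symm⟩ hgs)
    have hhu : h ∣ u := by
      rw [← hg, hu, mul_pow] at hgs
      exact (hsq.dvd_pow_iff_dvd two_ne_zero).1 (Nat.dvd_of_mul_dvd_mul_left (by positivity) hgs)
    obtain ⟨t, ht⟩ := hhu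
    have hst : s = f * h * t := by rw [hu, ht, mul_assoc]
    refine ⟨t, hst, ?_, ?_⟩
    · have h1 := hs.2
      have h2 : s ^ 2 + D = g * (h * t ^ 2 + E) := by rw [hst, hE, ← hg]; ring
      rw [h2, hM] at h1
      exact Nat.dvd_of_mul_dvd_mul_left hg0 h1
    · have h1 := hs.1
      rw [hst, hM, ← hg, show f ^ 2 * h * M = f * h * (f * M) by ring] at h1
      exact lt_of_mul_lt_mul_left h1 (Nat.zero_le _)
  rcases (negSquareRoots D B).eq_empty_or_nonempty with hemp | ⟨s₀, hs₀⟩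
  · simp [hemp]
  obtain ⟨r, -, hr, -⟩ := hstruct s₀ hs₀
  have hco : IsCoprime (M : ℤ) ((h : ℤ) * r) := by
    have : M.Coprime (h * r) := by
      refine Nat.Coprime.symm (Nat.coprime_of_dvd fun p hp h1 h2 => ?_)
      have h3 : p ∣ h * r ^ 2 := by rw [pow_two, ← mul_assoc]; exact h1.mul_right r
      have h4 : p ∣ E := (Nat.dvd_add_right h3).1 (h2.trans hr)
      exact hp.one_lt.ne' (Nat.dvd_one.1 (hME ▸ Nat.dvd_gcd h2 h4))
    exact_mod_cast Nat.isCoprime_iff_coprime.2 this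
  choose! T hT1 hT2 hT3 using hstruct
  have hcard : #(M.divisors ×ˢ range (2 * f)) = 2 * f * #M.divisors := by
    rw [card_product, card_range, mul_comm]
  rw [← hcard]
  refine card_le_card_of_injOn (fun s => (Int.gcd ((T s : ℤ) - r) M, 2 * T s / M)) ?_ ?_
  · intro s hs
    simp only [coe_product, Set.mem_prod, mem_coe, Nat.mem_divisors, mem_range]
    refine ⟨⟨Int.natCast_dvd_natCast.1 (Int.gcd_dvd_right _ _), hM0.ne'⟩, ?_⟩
    rw [Nat.div_lt_iff_lt_mul hM0]
    have := hT3 s hs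
    linarith
  · intro s hs s' hs' heq
    simp only [Prod.mk.injEq] at heq
    have hd := dvd_two_mul_sub_of_gcd_eq (D := E) hco (by exact_mod_cast hr)
      (by exact_mod_cast hT2 s hs) (by exact_mod_cast hT2 s' hs') heq.1 (by exact_mod_cast hM0.ne')
    have hmod : 2 * T s' ≡ 2 * T s [MOD M] := by
      rw [Nat.modEq_iff_dvd]
      push_cast
      rwa [← mul_sub]
    have h1 := Nat.div_add_mod (2 * T s) M
    have h2 := Nat.div_add_mod (2 * T s') M
    rw [← heq.2, hmod, h1] at h2
    rw [hT1 s hs, hT1 s' hs', show T s = T s' by omega]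

lemma sum_card_divisors_le (N : ℕ) :
    ∑ k ∈ Ioc 0 N, (#k.divisors : ℝ) ≤ N * (1 + Real.log N) := by
  have h := ArithmeticFunction.sum_Ioc_sigma0_eq_sum_div N
  simp only [ArithmeticFunction.sigma_zero_apply] at h
  have hR : ∑ k ∈ Ioc 0 N, (#k.divisors : ℝ) = ∑ k ∈ Ioc 0 N, ((N / k : ℕ) : ℝ) := by
    exact_mod_cast h
  rw [hR]
  calc ∑ k ∈ Ioc 0 N, ((N / k : ℕ) : ℝ) ≤ ∑ k ∈ Ioc 0 N, (N : ℝ) * (k : ℝ)⁻¹ :=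
        sum_le_sum fun k _ => by rw [← div_eq_mul_inv]; exact Nat.cast_div_le
    _ = N * (harmonic N : ℝ) := by
        rw [← mul_sum, harmonic_eq_sum_Icc]
        push_cast
        rfl
    _ ≤ _ := by gcongr; exact harmonic_le_one_add_log N

/-- Each term is `1 / (f * h)`, and `g ↦ (f, h)` injects into pairs of divisors of `D`. -/
lemma sum_divisors_squareRootPart_div_le (D : ℕ) :
    ∑ g ∈ D.divisors, (squareRootPart g : ℝ) / g ≤ reciprocalDivisorSum D ^ 2 := by
  have hinj : Set.InjOn (fun g => (squareRootPart g, squarefreePart g)) (D.divisors : Set ℕ) := by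
    intro a _ b _ hab
    simp only [Prod.mk.injEq] at hab
    rw [← squareRootPart_sq_mul a, hab.1, hab.2, squareRootPart_sq_mul]
  rw [pow_two, reciprocalDivisorSum, sum_mul_sum, ← sum_product']
  calc ∑ g ∈ D.divisors, (squareRootPart g : ℝ) / g
      = ∑ g ∈ D.divisors, (squareRootPart g : ℝ)⁻¹ * (squarefreePart g : ℝ)⁻¹ := by
        refine sum_congr rfl fun g hg => ?_
        have hg0 : (g : ℝ) ≠ 0 := by exact_mod_cast (Nat.pos_of_mem_divisors hg).ne'
        have h : (squareRootPart g : ℝ) ^ 2 * squarefreePart g = g := by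
          exact_mod_cast squareRootPart_sq_mul g
        have h1 : (squareRootPart g : ℝ) ≠ 0 := fun h0 => hg0 (by rw [← h, h0]; simp)
        have h2 : (squarefreePart g : ℝ) ≠ 0 := fun h0 => hg0 (by rw [← h, h0]; simp)
        rw [← mul_inv, div_eq_iff hg0, ← div_eq_inv_mul, eq_div_iff (by positivity), ← h]
        ring
    _ = ∑ x ∈ D.divisors.image fun g => (squareRootPart g, squarefreePart g),
          (x.1 : ℝ)⁻¹ * (x.2 : ℝ)⁻¹ := by rw [sum_image hinj]
    _ ≤ _ := by
        refine sum_le_sum_of_subset_of_nonneg (fun y hy => ?_) fun x _ _ => by positivity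
        obtain ⟨g, hg, rfl⟩ := mem_image.1 hy
        rw [Nat.mem_divisors] at hg
        have h := squareRootPart_sq_mul g
        simp only [mem_product, Nat.mem_divisors]
        exact ⟨⟨Dvd.dvd.trans ⟨squareRootPart g * squarefreePart g, by rw [← mul_assoc, ← pow_two, h]⟩
          hg.1, hg.2⟩, Dvd.dvd.trans ⟨_, (mul_comm _ _).trans h |>.symm⟩ hg.1, hg.2⟩

/-- On average over `B`, the number of square roots of `-D` modulo `B` is bounded by the logarithm
times the square of the sum of the reciprocals of the divisors of `D`. -/
lemma sum_card_negSquareRoots_le {D : ℕ} (hD : D ≠ 0) (X : ℕ) :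
    ∑ B ∈ Ioc 0 X, (#(negSquareRoots D B) : ℝ) ≤
      2 * X * (1 + Real.log X) * reciprocalDivisorSum D ^ 2 := by
  let F : ℕ × ℕ → ℝ := fun x => 2 * squareRootPart x.1 * #x.2.divisors
  have hinj : Set.InjOn (fun B => (⟨B.gcd D, B / B.gcd D⟩ : (_ : ℕ) × ℕ))
      (Ioc 0 X : Finset ℕ) := by
    intro a _ b _ hab
    simp only [Sigma.mk.injEq, heq_eq_eq] at hab
    rw [← Nat.div_mul_cancel (Nat.gcd_dvd_left a D), hab.2, hab.1,
      Nat.div_mul_cancel (Nat.gcd_dvd_left b D)]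
  calc ∑ B ∈ Ioc 0 X, (#(negSquareRoots D B) : ℝ)
      ≤ ∑ B ∈ Ioc 0 X, F (B.gcd D, B / B.gcd D) := by
        refine sum_le_sum fun B hB => ?_
        simp only [F]
        exact_mod_cast card_negSquareRoots_le (D := D) (mem_Ioc.1 hB).1
    _ = ∑ x ∈ (Ioc 0 X).image fun B => (⟨B.gcd D, B / B.gcd D⟩ : (_ : ℕ) × ℕ),
          F (x.1, x.2) := by rw [sum_image hinj]
    -- Only `g ∣ D` and `k ≤ X / g` are kept; the condition `gcd (g * k, D) = g` is dropped.
    _ ≤ ∑ x ∈ D.divisors.sigma fun g => Ioc 0 (X / g), F (x.1, x.2) := by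
        refine sum_le_sum_of_subset_of_nonneg (fun y hy => ?_) fun x _ _ => by
          simp only [F]; positivity
        obtain ⟨B, hB, rfl⟩ := mem_image.1 hy
        rw [mem_Ioc] at hB
        simp only [mem_sigma, Nat.mem_divisors, mem_Ioc]
        exact ⟨⟨Nat.gcd_dvd_right _ _, hD⟩,
          Nat.div_pos (Nat.gcd_le_left _ hB.1) (Nat.gcd_pos_of_pos_left _ hB.1),
          Nat.div_le_div_right hB.2⟩
    _ = ∑ g ∈ D.divisors, 2 * squareRootPart g * ∑ k ∈ Ioc 0 (X / g), (#k.divisors : ℝ) := by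
        rw [sum_sigma]
        exact sum_congr rfl fun g _ => by rw [mul_sum]
    _ ≤ ∑ g ∈ D.divisors, 2 * X * (1 + Real.log X) * ((squareRootPart g : ℝ) / g) := by
        refine sum_le_sum fun g hg => ?_
        have hlog : Real.log ((X / g : ℕ) : ℝ) ≤ Real.log X := by
          rcases Nat.eq_zero_or_pos (X / g) with h0 | h0
          · rw [h0, Nat.cast_zero, Real.log_zero]
            exact Real.log_natCast_nonneg X
          · exact Real.log_le_log (by exact_mod_cast h0) (by exact_mod_cast Nat.div_le_self X g)
        have hX : 0 ≤ 1 + Real.log X := by linarith [Real.log_natCast_nonneg X]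
        calc 2 * squareRootPart g * ∑ k ∈ Ioc 0 (X / g), (#k.divisors : ℝ)
            ≤ 2 * squareRootPart g * ((X : ℝ) / g * (1 + Real.log X)) := by
              gcongr
              refine (sum_card_divisors_le _).trans ?_
              have := Nat.cast_div_le (α := ℝ) (m := X) (n := g)
              gcongr
          _ = _ := by ring
    _ ≤ _ := by
        rw [← mul_sum]
        have hX : 0 ≤ 1 + Real.log X := by linarith [Real.log_natCast_nonneg X]
        gcongr
        exact sum_divisors_squareRootPart_div_le D

end SquareRootCount

end Apollonian

namespace Apollonian

/-! ### From root quadruples to square roots -/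

section RootCount

open Finset

/-- The map that sends a quadruple with smallest entry `-n` to the first two coefficients of the
binary quadratic form `(b - n, a + b + c - d, c - n)` attached to it, the second one halved. -/
def formCoeffs (n : ℕ) (v : Quadruple) : (_ : ℕ) × ℕ :=
  ⟨(v 1 - n).toNat, ((v 0 + v 1 + v 2 - v 3) / 2).toNat⟩

/-- A root quadruple with smallest entry `-n` is given by a reduced binary quadratic form of
determinant `n ^ 2 - m`. -/
lemma exists_form_of_mem_rootQuadruples {m : ℤ} {n D : ℕ} (hD : (D : ℤ) = n ^ 2 - m) (hD0 : D ≠ 0)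
    {v : Quadruple} (hv : v ∈ rootQuadruples (4 * m) (-n)) :
    ∃ B s C : ℕ, 0 < B ∧ 2 * s ≤ B ∧ B ≤ C ∧ B * C = s ^ 2 + D ∧
      v 0 = -n ∧ v 1 = B + n ∧ v 2 = C + n ∧ v 3 = v 0 + v 1 + v 2 - 2 * s := by
  obtain ⟨hroot, hQ, hL, h0⟩ := hv
  rcases hroot with ⟨hmono, -, -, hle, -⟩ | ⟨hneg, -⟩
  swap
  · exact absurd hL (not_lt.2 hneg.le)
  have h12 : v 1 ≤ v 2 := hmono (by decide)
  have h23 : v 2 ≤ v 3 := hmono (by decide)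
  simp only [descartesForm, Fin.sum_univ_four] at hQ
  have hsq : (v 0 + v 1 + v 2 - v 3) ^ 2 = 2 * (2 * (v 0 * v 1 + v 1 * v 2 + v 2 * v 0 + m)) := by
    linear_combination hQ
  have heven : Even (v 0 + v 1 + v 2 - v 3) :=
    (Int.even_pow.1 (hsq ▸ even_two_mul _)).1
  obtain ⟨s, hs⟩ := heven
  have hprod : (v 1 - n) * (v 2 - n) = s ^ 2 + D := by
    rw [hs, h0] at hsq
    rw [hD]
    linarith
  have hs0 : 0 ≤ s := by linarith
  -- This is `c ≤ d`; likewise `0 ≤ s` is `d ≤ a + b + c`.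
  have hBs : 2 * s ≤ v 1 - n := by linarith
  have hB0 : 0 < v 1 - n := by
    rcases lt_or_eq_of_le (show 0 ≤ v 1 - n by linarith) with h | h
    · exact h
    · rw [← h, zero_mul] at hprod
      have : (0 : ℤ) < D := by exact_mod_cast Nat.pos_of_ne_zero hD0
      nlinarith
  lift s to ℕ using hs0
  obtain ⟨B, hB⟩ := Int.eq_ofNat_of_zero_le hB0.le
  obtain ⟨C, hC⟩ := Int.eq_ofNat_of_zero_le (show 0 ≤ v 2 - n by linarith)
  refine ⟨B, s, C, by omega, by omega, by omega, ?_, h0, by omega, by omega, by omega⟩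
  rw [hB, hC] at hprod
  exact_mod_cast hprod

lemma Nroot_le_sum_card_negSquareRoots {m : ℤ} {n D : ℕ} (hD : (D : ℤ) = n ^ 2 - m) (hD0 : D ≠ 0)
    (hDn : D < 2 * n ^ 2) :
    Nroot (4 * m) (-n) ≤ ((∑ B ∈ Ioc 0 (2 * n), #(negSquareRoots D B) : ℕ) : ℕ∞) := by
  rw [Nroot, ← card_sigma, ← Set.encard_coe_eq_coe_finsetCard]
  have hcoeffs : ∀ (v : Quadruple) (B s : ℕ), v 0 = -n → v 1 = B + n →
      v 3 = v 0 + v 1 + v 2 - 2 * s → formCoeffs n v = ⟨B, s⟩ := by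
    intro v B s _ h1 h3
    have hb : (v 1 - n).toNat = B := by omega
    have hs : ((v 0 + v 1 + v 2 - v 3) / 2).toNat = s := by omega
    rw [formCoeffs, hb, hs]
  refine Set.encard_le_encard_of_injOn (f := formCoeffs n) ?_ ?_
  · intro v hv
    obtain ⟨B, s, C, hB, hsB, hBC, hprod, h0, h1, -, h3⟩ :=
      exists_form_of_mem_rootQuadruples hD hD0 hv
    rw [hcoeffs v B s h0 h1 h3]
    simp only [coe_sigma, Set.mem_sigma_iff, mem_coe, mem_Ioc, negSquareRoots, mem_filter,
      mem_range]
    -- `B ^ 2 ≤ B * C = s ^ 2 + D ≤ B ^ 2 / 4 + D` and `D < 2 * n ^ 2` give `B ≤ 2 * n`.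
    exact ⟨⟨hB, by nlinarith⟩, by omega, Dvd.intro _ hprod⟩
  · intro v hv w hw hvw
    obtain ⟨B, s, C, hB, -, -, hprod, h0, h1, h2, h3⟩ :=
      exists_form_of_mem_rootQuadruples hD hD0 hv
    obtain ⟨B', s', C', -, -, -, hprod', h0', h1', h2', h3'⟩ :=
      exists_form_of_mem_rootQuadruples hD hD0 hw
    rw [hcoeffs v B s h0 h1 h3, hcoeffs w B' s' h0' h1' h3'] at hvw
    simp only [Sigma.mk.injEq, heq_eq_eq] at hvw
    obtain ⟨rfl, rfl⟩ := hvw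
    have hC : C = C' := Nat.eq_of_mul_eq_mul_left hB (hprod.trans hprod'.symm)
    subst hC
    ext i
    fin_cases i
    · exact h0.trans h0'.symm
    · exact h1.trans h1'.symm
    · exact h2.trans h2'.symm
    · change v 3 = w 3
      rw [h3, h3', h0, h0', h1, h1', h2, h2']

/-- `log log n` is negative at `n = 2` and positive from `n = 3` on. As it never vanishes, a single
constant serves every `n ≥ 2`. -/
lemma exists_log_le_mul_abs_log_log :
    ∃ K : ℝ, ∀ n : ℕ, 2 ≤ n → Real.log (3 * Real.log n + 3) ≤ K * |Real.log (Real.log n)| := by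
  have hlog2 : 0 < Real.log 2 := Real.log_pos one_lt_two
  have hδ2 : 0 < |Real.log (Real.log 2)| :=
    abs_pos.2 (Real.log_neg hlog2 (by linarith [Real.log_two_lt_d9])).ne
  have hlog3 : 1 < Real.log 3 := by
    rw [Real.lt_log_iff_exp_lt (by norm_num)]
    linarith [Real.exp_one_lt_d9]
  have hδ3 : 0 < Real.log (Real.log 3) := Real.log_pos hlog3
  set K₂ := Real.log (3 * Real.log 2 + 3) / |Real.log (Real.log 2)|
  set K₃ := Real.log 6 / Real.log (Real.log 3) + 1
  refine ⟨max K₂ K₃, fun n hn => ?_⟩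
  rcases hn.eq_or_lt with rfl | hn
  · have : Real.log (3 * Real.log 2 + 3) = K₂ * |Real.log (Real.log 2)| :=
      (div_mul_cancel₀ _ hδ2.ne').symm
    push_cast
    rw [this]
    gcongr
    exact le_max_left _ _
  · have hn3 : (3 : ℝ) ≤ n := by exact_mod_cast hn
    have hle : Real.log 3 ≤ Real.log n := Real.log_le_log (by norm_num) hn3
    have hle' : Real.log (Real.log 3) ≤ Real.log (Real.log n) :=
      Real.log_le_log (by linarith) hle
    have h6 : 0 < Real.log 6 := Real.log_pos (by norm_num)
    rw [abs_of_pos (hδ3.trans_le hle')]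
    calc Real.log (3 * Real.log n + 3) ≤ Real.log (6 * Real.log n) :=
          Real.log_le_log (by linarith) (by linarith)
      _ = Real.log 6 + Real.log (Real.log n) := Real.log_mul (by norm_num) (by linarith)
      _ = Real.log 6 / Real.log (Real.log 3) * Real.log (Real.log 3) + Real.log (Real.log n) := by
          rw [div_mul_cancel₀ _ hδ3.ne']
      _ ≤ Real.log 6 / Real.log (Real.log 3) * Real.log (Real.log n) + Real.log (Real.log n) := by
          gcongr
      _ = K₃ * Real.log (Real.log n) := by ring
      _ ≤ _ := by
          have := hδ3.trans_le hle'
          gcongr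
          exact le_max_right _ _

end RootCount

end Apollonian

theorem theorem4p3 :
    ∃ C : ℝ, ∀ (m : ℤ) (n : ℕ), 2 ≤ n → Real.sqrt |(m : ℝ)| < (n : ℝ) →
      ∃ N : ℕ, Apollonian.Nroot (4 * m) (-(n : ℤ)) = (N : ℕ∞) ∧
        (N : ℝ) ≤ C * ((n : ℝ) * Real.log n * Real.log (Real.log n) ^ 2) := by
  obtain ⟨K, hK⟩ := Apollonian.exists_log_le_mul_abs_log_log
  set A : ℝ := 2 * Real.exp (Real.log 4 + 6)
  refine ⟨16 * (A * K) ^ 2, fun m n hn hm => ?_⟩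
  have hn2 : (2 : ℝ) ≤ n := by exact_mod_cast hn
  have hmn : |m| < (n : ℤ) ^ 2 := by
    rw [Real.sqrt_lt' (by linarith)] at hm
    exact_mod_cast hm
  obtain ⟨hm1, hm2⟩ := abs_lt.1 hmn
  obtain ⟨D, hD⟩ := Int.eq_ofNat_of_zero_le (show 0 ≤ (n : ℤ) ^ 2 - m by linarith)
  have hD0 : D ≠ 0 := by omega
  have hDn : D < 2 * n ^ 2 := by zify; linarith
  have hle := Apollonian.Nroot_le_sum_card_negSquareRoots hD.symm hD0 hDn
  obtain ⟨N, hN⟩ := ENat.ne_top_iff_exists.1 (ne_top_of_le_ne_top (ENat.natCast_ne_top _) hle)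
  refine ⟨N, hN.symm, ?_⟩
  rw [← hN] at hle
  have hNle : (N : ℝ) ≤ ∑ B ∈ Finset.Ioc 0 (2 * n), ((Apollonian.negSquareRoots D B).card : ℝ) := by
    exact_mod_cast hle
  have hlog2 : Real.log 2 ≤ Real.log n := Real.log_le_log two_pos hn2
  have hlog2' := Real.log_two_gt_d9
  have hlogn : 0 < Real.log n := by linarith
  -- The summand `3` secures the condition `3 ≤ y` of `reciprocalDivisorSum_le`.
  have hlogD : Real.log D ≤ 3 * Real.log n + 3 := by
    have h1 : Real.log D ≤ Real.log (2 * (n : ℝ) ^ 2) :=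
      Real.log_le_log (by exact_mod_cast Nat.pos_of_ne_zero hD0) (by exact_mod_cast hDn.le)
    rw [Real.log_mul two_ne_zero (by positivity), Real.log_pow] at h1
    push_cast at h1
    linarith
  have hσ : Apollonian.reciprocalDivisorSum D ≤ A * (K * |Real.log (Real.log n)|) :=
    (Apollonian.reciprocalDivisorSum_le (by linarith) hlogD).trans
      (mul_le_mul_of_nonneg_left (hK n hn) (by positivity))
  have hσ2 : Apollonian.reciprocalDivisorSum D ^ 2 ≤ (A * K) ^ 2 * Real.log (Real.log n) ^ 2 := by
    refine (pow_le_pow_left₀ (Apollonian.reciprocalDivisorSum_nonneg D) hσ 2).trans_eq ?_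
    rw [← sq_abs (Real.log (Real.log n))]
    ring
  have hlog2n : 1 + Real.log ((2 * n : ℕ) : ℝ) ≤ 4 * Real.log n := by
    push_cast
    rw [Real.log_mul two_ne_zero (by positivity)]
    linarith
  calc (N : ℝ) ≤ 2 * ((2 * n : ℕ) : ℝ) * (1 + Real.log ((2 * n : ℕ) : ℝ)) *
        Apollonian.reciprocalDivisorSum D ^ 2 :=
        hNle.trans (Apollonian.sum_card_negSquareRoots_le hD0 _)
    _ ≤ 2 * ((2 * n : ℕ) : ℝ) * (4 * Real.log n) *
        ((A * K) ^ 2 * Real.log (Real.log n) ^ 2) := by gcongr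
    _ = 16 * (A * K) ^ 2 * ((n : ℝ) * Real.log n * Real.log (Real.log n) ^ 2) := by
        push_cast
        ring
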